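/- Let $X$ be a real Banach space admitting a $C^1$ Lipschitz bump function (a $C^1$, Lipschitz function $b:X\to\mathbb R$ with nonempty bounded support), and let $M$ be a connected paracompact Hausdorff $C^1$ manifold modeled on $X$ with a $C^1$ Finsler structure in the sense of Palais: a continuous map $\|\cdot\|_M:TM\to[0,\infty)$ whose restriction $\|\cdot\|_x$ to each $T_xM$ is a norm, such that for every chart $\varphi:U\to X$: (P1) for $x\in U$ the norm $v\mapsto\|d\varphi^{-1}(\varphi(x))(v)\|_x$ is equivalent to the norm of $X$; (P2) for every $x_0\in U$ and $\varepsilon>0$ there is an open neighborhood $W\subset U$ of $x_0$ such that $\frac1{1+\varepsilon}\|d\varphi^{-1}(\varphi(x_0))(v)\|_{x_0}\le\|d\varphi^{-1}(\varphi(x))(v)\|_x\le(1+\varepsilon)\|d\varphi^{-1}(\varphi(x_0))(v)\|_{x_0}$ for all $x\in W$, $v\in X$. Let $\Omega\subset M$ be open and let $F:T\Omega^*\times\mathbb R\to\mathbb R$ be continuous, where $T\Omega^*$ is the part over $\Omega$ of the cotangent bundle $TM^*$ (with the topology given by the dual norm in charts). For $f:\Omega\to\mathbb R$ and $x\in\Omega$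 let $D^-f(x)$ (resp. $D^+f(x)$) be the set of all $dg(x)\in T_xM^*$ with $g:M\to\mathbb R$ of class $C^1$ such that $f-g$ attains a local minimum (resp. local maximum) at $x$. A function $w:\Omega\to\mathbb R$ is a viscosity subsolution of $$F(x,du(x),u(x))=0 \qquad (\ast)$$ on $\Omega$ if $w$ is upper semicontinuous and $F(x,\Delta,w(x))\le 0$ for all $x\in\Omega$ and $\Delta\in D^+w(x)$; it is a viscosity supersolution if $w$ is lower semicontinuous and $F(x,\Delta,w(x))\ge 0$ for all $x\in\Omega$ and $\Delta\in D^-w(x)$. For $w:\Omega\to\mathbb R$ put $$w^*(x)=\inf\{v(x):\ v:\Omega\to\mathbb R\text{ continuous},\ w\le v\text{ on }\Omega\},\qquad w_*(x)=\sup\{v(x):\ v:\Omega\to\mathbb R\text{ continuous},\ v\le w\text{ on }\Omega\}.$$ Let $s_0,s_1:\Omega\to\mathbb R$ be continuous functions with $s_0\le s_1$ on $\Omega$ such that $s_0$ is a viscosity subsolution and $s_1$ a viscosity supersolution of $(\ast)$ on $\Omega$. Let $$\mathcal F=\{w:\Omega\to\mathbb R:\ s_0\le w\le s_1\text{ on }\Omega\text{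 and } w\text{ is a viscosity subsolution of }(\ast)\text{ on }\Omega\}$$ and let $u=\sup\mathcal F$ (pointwise supremum). Then $u^*$ is a viscosity subsolution of $(\ast)$ on $\Omega$, $(u^*)_*$ is a viscosity supersolution of $(\ast)$ on $\Omega$, and $s_0\le(u^*)_*\le u^*\le s_1$ on $\Omega$. -/

import Mathlib

open Set Filter Topology Bundle
open scoped Manifold ContDiff

noncomputable section

/-- A Banach space `X` has a `C¹` Lipschitz bump function: a `C¹`, Lipschitz function `b : X → ℝ`
whose support (the closure of `{b ≠ 0}`) is nonempty and bounded. -/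
def HasC1LipschitzBump (X : Type*) [NormedAddCommGroup X] [NormedSpace ℝ X] : Prop :=
  ∃ b : X → ℝ, ContDiff ℝ 1 b ∧ (∃ K : NNReal, LipschitzWith K b) ∧
    (tsupport b).Nonempty ∧ Bornology.IsBounded (tsupport b)

section Finsler

variable {X : Type*} [NormedAddCommGroup X] [NormedSpace ℝ X]
variable {M : Type*} [TopologicalSpace M] [ChartedSpace X M]

/-- For `N : TM → ℝ` and a chart `φ` of `M`, the function `v ↦ ‖dφ⁻¹(φ(x))(v)‖_x` on `X`. -/
def chartNorm (N : TangentBundle 𝓘(ℝ, X) M → ℝ) (φ : OpenPartialHomeomorph M X) (x : M)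
    (v : X) : ℝ :=
  N (tangentMap 𝓘(ℝ, X) 𝓘(ℝ, X) φ.symm ⟨φ x, v⟩)

variable [IsManifold 𝓘(ℝ, X) 1 M]

/-- `N : TM → ℝ` is a `C¹` Finsler structure in the sense of Palais. Charts are all the charts of
the maximal `C¹` atlas of `M`. -/
structure IsPalaisFinsler (N : TangentBundle 𝓘(ℝ, X) M → ℝ) : Prop where
  continuous : Continuous N
  nonneg : ∀ p, 0 ≤ N p
  /-- (P1), first part: the restriction to each tangent space is a norm. -/
  add_le : ∀ (x : M) (v w : TangentSpace 𝓘(ℝ, X) x), N ⟨x, v + w⟩ ≤ N ⟨x, v⟩ + N ⟨x, w⟩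
  smul : ∀ (x : M) (c : ℝ) (v : TangentSpace 𝓘(ℝ, X) x), N ⟨x, c • v⟩ = |c| * N ⟨x, v⟩
  eq_zero : ∀ (x : M) (v : TangentSpace 𝓘(ℝ, X) x), N ⟨x, v⟩ = 0 → v = 0
  /-- (P1), second part: in every chart this norm is equivalent to the norm of `X`. -/
  equivalent : ∀ φ ∈ IsManifold.maximalAtlas 𝓘(ℝ, X) 1 M, ∀ x ∈ φ.source,
    ∃ K : ℝ, 1 ≤ K ∧ ∀ v : X, K⁻¹ * ‖v‖ ≤ chartNorm N φ x v ∧ chartNorm N φ x v ≤ K * ‖v‖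
  /-- (P2). -/
  palais : ∀ φ ∈ IsManifold.maximalAtlas 𝓘(ℝ, X) 1 M, ∀ x₀ ∈ φ.source, ∀ ε : ℝ, 0 < ε →
    ∃ W : Set M, IsOpen W ∧ x₀ ∈ W ∧ W ⊆ φ.source ∧ ∀ x ∈ W, ∀ v : X,
      (1 + ε)⁻¹ * chartNorm N φ x₀ v ≤ chartNorm N φ x v ∧
        chartNorm N φ x v ≤ (1 + ε) * chartNorm N φ x₀ v

end Finsler

section Envelopes

variable {S : Type*} [TopologicalSpace S]

/-- Upper semicontinuous envelope `u^*` (for functions with a continuous majorant). -/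
def upperEnvelope (u : S → ℝ) (x : S) : ℝ :=
  sInf {t : ℝ | ∃ v : S → ℝ, Continuous v ∧ (∀ y, u y ≤ v y) ∧ v x = t}

/-- Lower semicontinuous envelope `u_*` (for functions with a continuous minorant). -/
def lowerEnvelope (u : S → ℝ) (x : S) : ℝ :=
  sSup {t : ℝ | ∃ v : S → ℝ, Continuous v ∧ (∀ y, v y ≤ u y) ∧ v x = t}

end Envelopes

section Viscosity

variable {X : Type*} [NormedAddCommGroup X] [NormedSpace ℝ X]
variable {M : Type*} [TopologicalSpace M] [ChartedSpace X M]

/-- The set `D⁻f(x) ⊆ T_xM^*` of subdifferentials at `x` of a function `f` on an open set `Ω`. -/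
def subdifferential {Ω : TopologicalSpace.Opens M} (f : Ω → ℝ) (x : Ω) :
    Set (TangentSpace 𝓘(ℝ, X) (x : M) →L[ℝ] ℝ) :=
  {Δ | ∃ g : M → ℝ, ContMDiff 𝓘(ℝ, X) 𝓘(ℝ, ℝ) 1 g ∧
    IsLocalMin (fun y : Ω => f y - g y) x ∧ mvfderiv 𝓘(ℝ, X) g (x : M) = Δ}

/-- The set `D⁺f(x) ⊆ T_xM^*` of superdifferentials at `x` of a function `f` on an open set `Ω`. -/
def superdifferential {Ω : TopologicalSpace.Opens M} (f : Ω → ℝ) (x : Ω) :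
    Set (TangentSpace 𝓘(ℝ, X) (x : M) →L[ℝ] ℝ) :=
  {Δ | ∃ g : M → ℝ, ContMDiff 𝓘(ℝ, X) 𝓘(ℝ, ℝ) 1 g ∧
    IsLocalMax (fun y : Ω => f y - g y) x ∧ mvfderiv 𝓘(ℝ, X) g (x : M) = Δ}

variable [IsManifold 𝓘(ℝ, X) 1 M]

variable (X M) in
/-- The cotangent bundle `TM^*`, with its topology as a vector bundle whose fibres are the dual
Banach spaces of the tangent spaces (i.e. the dual norm topology in charts). -/
abbrev CotangentBundle : Type _ :=
  TotalSpace (X →L[ℝ] ℝ)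
    (fun x : M => TangentSpace 𝓘(ℝ, X) x →L[ℝ] Bundle.Trivial M ℝ x)

variable (X) in
/-- `TΩ^*`, the part of the cotangent bundle over an open set `Ω`, with the subspace topology. -/
abbrev CotangentBundleOver (Ω : TopologicalSpace.Opens M) : Type _ :=
  {p : CotangentBundle X M // p.proj ∈ Ω}

/-- The covector `Δ` at `x ∈ Ω`, as a point `(x, Δ)` of `TΩ^*`. -/
def covectorAt {Ω : TopologicalSpace.Opens M} (x : Ω)
    (Δ : TangentSpace 𝓘(ℝ, X) (x : M) →L[ℝ] ℝ) : CotangentBundleOver X Ω :=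
  ⟨⟨(x : M), Δ⟩, x.2⟩

/-- `u` is a viscosity subsolution of `F(x, du(x), u(x)) = 0` on `Ω`. -/
def IsViscositySubsolution {Ω : TopologicalSpace.Opens M}
    (F : CotangentBundleOver X Ω × ℝ → ℝ) (u : Ω → ℝ) : Prop :=
  UpperSemicontinuous u ∧
    ∀ x : Ω, ∀ Δ ∈ superdifferential (X := X) u x, F (covectorAt x Δ, u x) ≤ 0

/-- `u` is a viscosity supersolution of `F(x, du(x), u(x)) = 0` on `Ω`. -/
def IsViscositySupersolution {Ω : TopologicalSpace.Opens M}
    (F : CotangentBundleOver X Ω × ℝ → ℝ) (u : Ω → ℝ) : Prop :=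
  LowerSemicontinuous u ∧
    ∀ x : Ω, ∀ Δ ∈ subdifferential (X := X) u x, 0 ≤ F (covectorAt x Δ, u x)

/-- The family of all viscosity subsolutions `w` with `s₀ ≤ w ≤ s₁` on `Ω`. -/
def perronFamily {Ω : TopologicalSpace.Opens M}
    (F : CotangentBundleOver X Ω × ℝ → ℝ) (s₀ s₁ : Ω → ℝ) : Set (Ω → ℝ) :=
  {w | (∀ x, s₀ x ≤ w x) ∧ (∀ x, w x ≤ s₁ x) ∧ IsViscositySubsolution F w}

/-- The pointwise supremum of the Perron family. -/
def perronSup {Ω : TopologicalSpace.Opens M}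
    (F : CotangentBundleOver X Ω × ℝ → ℝ) (s₀ s₁ : Ω → ℝ) (x : Ω) : ℝ :=
  sSup {t : ℝ | ∃ w ∈ perronFamily F s₀ s₁, w x = t}

end Viscosity

end

/-! This is Perron's method. First, the upper envelope of a supremum of subsolutions is a
subsolution (`isViscositySubsolution_upperEnvelope`). Hence `u^*` itself belongs to the Perron
family and is its largest element. Second, if the lower envelope of a largest element failed the
supersolution test at some point, raising that element by a small `C¹` bump there would give a
strictly larger member of the family (`isViscositySupersolution_lowerEnvelope`). The upper barrier
leaves room for the bump: where the lower envelope meets `s₁`, the test function also touches `s₁`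
from below.

The difficulty in the first half is that balls of `X` need not be compact, so the usual limit of
maximum points is unavailable. It is replaced by a smooth variational principle
(`exists_perturbation_isMax`), which turns a near-maximum into an exact one at the cost of a
perturbation small in `C¹`. This yields a local comparison of subsolutions with strict `C¹`
supersolutions in a chart (`le_on_chart_ball`). If `u^*` is touched from above at `x` by `κ` with `F
> 0`, every member of the family then lies below a modification of `κ` lowered near `x`, and so does
`u^*`, a contradiction. -/

/-! ### Lipschitz bumps and a smooth variational principle. -/

theorem Real.smoothTransition_exists_lipschitzWith :
    ∃ K : NNReal, LipschitzWith K Real.smoothTransition := by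
  obtain ⟨K, hK⟩ := (Real.smoothTransition.contDiff (n := 1)).contDiffOn.exists_lipschitzOnWith
    one_ne_zero (convex_Icc (0 : ℝ) 1) isCompact_Icc
  -- The function is constant on each side of `[0, 1]`, so it factors through the 1-Lipschitz
  -- projection onto that interval.
  have h := (lipschitzOnWith_iff_restrict.1 hK).comp
    (LipschitzWith.projIcc (zero_le_one' ℝ))
  have he : (Icc (0 : ℝ) 1).domRestrict Real.smoothTransition ∘ projIcc 0 1 zero_le_one
      = Real.smoothTransition := funext fun x ↦ Real.smoothTransition.projIcc
  rw [he] at h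
  exact ⟨_, h⟩

/-- A bump function at scale `r`, whose derivative is bounded by a constant multiple of `1 / r`. -/
theorem HasC1LipschitzBump.exists_scaled {X : Type*} [NormedAddCommGroup X] [NormedSpace ℝ X]
    (hX : HasC1LipschitzBump X) :
    ∃ K : ℝ, 0 ≤ K ∧ ∀ (a : X) (r : ℝ), 0 < r → ∃ b : X → ℝ, ContDiff ℝ 1 b ∧
      (∀ z, ‖fderiv ℝ b z‖ ≤ K / r) ∧ (∀ z, 0 ≤ b z) ∧ (∀ z, b z ≤ 1) ∧
      (∀ᶠ z in 𝓝 a, b z = 1) ∧ ∀ z, r ≤ dist z a → b z = 0 := by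
  obtain ⟨b, hb, ⟨L, hL⟩, hne, hbd⟩ := hX
  obtain ⟨y, hy⟩ : ∃ y, b y ≠ 0 := by
    by_contra! h
    have : b = 0 := funext h
    simp [this] at hne
  obtain ⟨R, hR0, hR⟩ := hbd.subset_closedBall_lt 0 0
  have hbR : ∀ z, R < ‖z‖ → b z = 0 := fun z hz ↦ by
    by_contra h
    have := hR (subset_tsupport _ h)
    rw [mem_closedBall_zero_iff] at this
    linarith
  obtain ⟨K, hK⟩ := Real.smoothTransition_exists_lipschitzWith
  -- With dilation factor `S / r` about `a`, points at distance at least `r` from `a` land outside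
  -- the ball of radius `R` that contains the support. At `a` the argument of the transition is `2`,
  -- so the new bump equals `1` on a whole neighbourhood.
  set S := R + ‖y‖ + 1 with hS
  have hS0 : 0 < S := by positivity
  refine ⟨K * (2 / |b y|) * L * S, by positivity, fun a r hr ↦
    ⟨fun z ↦ Real.smoothTransition (2 * b (y + (S / r) • (z - a)) / b y), ?_, ?_, ?_, ?_, ?_, ?_⟩⟩
  · refine Real.smoothTransition.contDiff.comp ?_
    refine (contDiff_const.mul (hb.comp ?_)).div_const _
    fun_prop
  · intro z
    have hlip : LipschitzWith (Real.toNNReal (K * (2 / |b y|) * L * S / r))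
        (fun z ↦ Real.smoothTransition (2 * b (y + (S / r) • (z - a)) / b y)) := by
      refine LipschitzWith.of_dist_le_mul fun z w ↦ ?_
      rw [Real.coe_toNNReal _ (by positivity)]
      refine (hK.dist_le_mul _ _).trans ?_
      have h1 : dist (2 * b (y + (S / r) • (z - a)) / b y) (2 * b (y + (S / r) • (w - a)) / b y)
          = 2 / |b y| * dist (b (y + (S / r) • (z - a))) (b (y + (S / r) • (w - a))) := by
        rw [Real.dist_eq, Real.dist_eq, ← sub_div, ← mul_sub, abs_div, abs_mul, abs_two]
        ring
      have h2 := hL.dist_le_mul (y + (S / r) • (z - a)) (y + (S / r) • (w - a))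
      have h3 : dist (y + (S / r) • (z - a)) (y + (S / r) • (w - a)) = S / r * dist z w := by
        rw [dist_add_left, dist_smul₀, dist_sub_right, Real.norm_of_nonneg (by positivity)]
      rw [h3] at h2
      rw [h1]
      calc (K : ℝ) * (2 / |b y| * dist (b (y + (S / r) • (z - a))) (b (y + (S / r) • (w - a))))
          ≤ K * (2 / |b y| * (L * (S / r * dist z w))) := by gcongr
        _ = _ := by ring
    have := norm_fderiv_le_of_lipschitz ℝ hlip (x₀ := z)
    rwa [Real.coe_toNNReal _ (by positivity)] at this
  · exact fun z ↦ Real.smoothTransition.nonneg _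
  · exact fun z ↦ Real.smoothTransition.le_one _
  · have hc : ContinuousAt (fun z ↦ 2 * b (y + (S / r) • (z - a)) / b y) a := by
      have := hb.continuous
      fun_prop
    have h1 : (1 : ℝ) < 2 * b (y + (S / r) • (a - a)) / b y := by
      simp [hy]
    filter_upwards [hc.eventually (lt_mem_nhds h1)] with z hz
    exact Real.smoothTransition.one_of_one_le hz.le
  · intro z hz
    have : R < ‖y + (S / r) • (z - a)‖ := by
      have h1 : S ≤ ‖(S / r) • (z - a)‖ := by
        rw [norm_smul, Real.norm_of_nonneg (by positivity), ← dist_eq_norm]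
        calc S = S / r * r := by field_simp
          _ ≤ _ := by gcongr
      have h2 := norm_sub_le (y + (S / r) • (z - a)) y
      rw [add_sub_cancel_left] at h2
      linarith
    simp [hbR _ this]

/-- A smooth variational principle: a bounded above upper semicontinuous function attains its
maximum after a small `C¹` perturbation. -/
theorem HasC1LipschitzBump.exists_perturbation_isMax {X : Type*} [NormedAddCommGroup X]
    [NormedSpace ℝ X] [CompleteSpace X] (hX : HasC1LipschitzBump X) {f : X → ℝ}
    (hf : UpperSemicontinuous f) (hbdd : BddAbove (range f)) {ε : ℝ} (hε : 0 < ε) :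
    ∃ p : X → ℝ, ContDiff ℝ 1 p ∧ (∀ z, 0 ≤ p z) ∧ (∀ z, p z ≤ ε) ∧
      (∀ z, ‖fderiv ℝ p z‖ ≤ ε) ∧ ∃ z, ∀ y, f y + p y ≤ f z + p z := by
  obtain ⟨K, hK0, hB⟩ := hX.exists_scaled
  have hr : ∀ n : ℕ, (0 : ℝ) < (1 / 2) ^ n := fun n ↦ by positivity
  choose B hBc hBd hB0 hB1 hBa hBr using fun (a : X) (n : ℕ) ↦ hB a _ (hr n)
  -- With the hypotheses placed inside the existential, near-maximizers are given by a total
  -- function, so the recursion for `G` need not carry boundedness proofs.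
  have hsel : ∀ (g : X → ℝ) (η : ℝ), ∃ x, BddAbove (range g) → 0 < η → ∀ y, g y ≤ g x + η := by
    intro g η
    by_cases h : BddAbove (range g) ∧ 0 < η
    · obtain ⟨_, ⟨x, rfl⟩, hx⟩ := exists_lt_of_lt_csSup (range_nonempty g)
        (sub_lt_self (sSup (range g)) h.2)
      exact ⟨x, fun _ _ y ↦ by linarith [le_csSup h.1 (mem_range_self y)]⟩
    · exact ⟨0, fun h1 h2 ↦ absurd ⟨h1, h2⟩ h⟩
  choose sel hsel using hsel
  set c : ℝ := ε / (2 * (K + 1)) with hc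
  have hc0 : 0 < c := by positivity
  have hcK : c * (K + 1) = ε / 2 := by rw [hc]; field_simp
  -- Heights decay like `4⁻ⁿ` and radii like `2⁻ⁿ`, so the gradients, of order height over radius,
  -- are still summable.
  let C : ℕ → ℝ := fun n ↦ c * (1 / 4) ^ n
  have hC0 : ∀ n, 0 < C n := fun n ↦ by positivity
  let G : ℕ → X → ℝ := fun n ↦ Nat.rec f (fun n g y ↦ g y + C n * B (sel g (C n / 4)) n y) n
  let x : ℕ → X := fun n ↦ sel (G n) (C n / 4)
  let q : ℕ → X → ℝ := fun n y ↦ C n * B (x n) n y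
  have hGs : ∀ n y, G (n + 1) y = G n y + q n y := fun n y ↦ rfl
  have hq0 : ∀ n y, 0 ≤ q n y := fun n y ↦ mul_nonneg (hC0 n).le (hB0 _ _ _)
  have hqC : ∀ n y, q n y ≤ C n := fun n y ↦
    mul_le_of_le_one_right (hC0 n).le (hB1 _ _ _)
  have hGb : ∀ n, BddAbove (range (G n)) := by
    intro n
    induction n with
    | zero => exact hbdd
    | succ n ih =>
      obtain ⟨m, hm⟩ := ih
      refine ⟨m + C n, ?_⟩
      rintro _ ⟨y, rfl⟩
      rw [hGs]
      exact add_le_add (hm (mem_range_self y)) (hqC n y)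
  have hx : ∀ n y, G n y ≤ G n (x n) + C n / 4 := fun n ↦
    hsel _ _ (hGb n) (by linarith [hC0 n])
  have hCs : ∀ n, C (n + 1) = C n / 4 := fun n ↦ by simp only [C, pow_succ]; ring
  -- The `n`-th bump raises `x n` by `C n`, more than the total slack `C n / 4 + C n / 16`. The next
  -- near-maximizer must therefore lie within the radius of that bump.
  have hdist : ∀ n, dist (x n) (x (n + 1)) ≤ 1 * (1 / 2) ^ n := by
    intro n
    by_contra! h
    have h1 : q n (x (n + 1)) = 0 := by
      simp only [q]
      rw [hBr _ _ _ (by rw [dist_comm]; linarith), mul_zero]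
    have h2 : q n (x n) = C n := by
      simp only [q]
      rw [(hBa (x n) n).self_of_nhds, mul_one]
    have h3 := hx (n + 1) (x n)
    rw [hGs, hGs, h1, h2, hCs] at h3
    linarith [hx n (x (n + 1)), hC0 n]
  obtain ⟨z, hz⟩ := cauchySeq_tendsto_of_complete
    (cauchySeq_of_le_geometric _ _ (by norm_num) hdist)
  have hCsum : HasSum C (c * (1 - 1 / 4)⁻¹) :=
    (hasSum_geometric_of_lt_one (by norm_num) (by norm_num)).mul_left c
  have hqsum : ∀ y, Summable fun n ↦ q n y := fun y ↦
    hCsum.summable.of_nonneg_of_le (fun n ↦ hq0 n y) (fun n ↦ hqC n y)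
  have hqd : ∀ n, ContDiff ℝ 1 (q n) := fun n ↦ contDiff_const.mul (hBc _ _)
  have hDsum : HasSum (fun n : ℕ ↦ c * K * (1 / 2 : ℝ) ^ n) (c * K * (1 - 1 / 2)⁻¹) :=
    (hasSum_geometric_of_lt_one (by norm_num) (by norm_num)).mul_left _
  have hqf : ∀ n y, ‖fderiv ℝ (q n) y‖ ≤ c * K * (1 / 2) ^ n := by
    intro n y
    have h1 : fderiv ℝ (q n) y = C n • fderiv ℝ (B (x n) n) y :=
      fderiv_const_mul ((hBc _ _).differentiable one_ne_zero y) _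
    rw [h1, norm_smul, Real.norm_of_nonneg (hC0 n).le]
    calc C n * ‖fderiv ℝ (B (x n) n) y‖ ≤ C n * (K / (1 / 2) ^ n) :=
          mul_le_mul_of_nonneg_left (hBd _ _ _) (hC0 n).le
      _ = c * K * (1 / 2) ^ n := by
        have : (1 / 4 : ℝ) ^ n = (1 / 2) ^ n * (1 / 2) ^ n := by
          rw [← mul_pow]; norm_num
        simp only [C, this]
        field_simp
  set p : X → ℝ := fun y ↦ ∑' n, q n y with hp
  have hGq : ∀ n y, G n y = f y + ∑ k ∈ Finset.range n, q k y := by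
    intro n y
    induction n with
    | zero => simp [G]
    | succ n ih => rw [hGs, ih, Finset.sum_range_succ]; ring
  have hlow : ∀ n y, G n y ≤ f y + p y := fun n y ↦ by
    rw [hGq]
    exact add_le_add_right ((hqsum y).sum_le_tsum _ fun k _ ↦ hq0 k y) _
  have hupp : ∀ n y, f y + p y ≤ G n y + 2 * C n := fun n y ↦ by
    have h1 : p y = ∑ k ∈ Finset.range n, q k y + ∑' k, q (k + n) y :=
      ((hqsum y).sum_add_tsum_nat_add n).symm
    have h2 : HasSum (fun k ↦ C (k + n)) (C n * (1 - 1 / 4)⁻¹) := by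
      have he : (fun k ↦ C (k + n)) = fun k ↦ C n * (1 / 4) ^ k := by
        funext k
        simp only [C, pow_add]; ring
      rw [he]
      exact (hasSum_geometric_of_lt_one (by norm_num) (by norm_num)).mul_left (C n)
    have h3 : ∑' k, q (k + n) y ≤ C n * (1 - 1 / 4)⁻¹ :=
      hasSum_le (fun k ↦ hqC _ y) ((summable_nat_add_iff n).2 (hqsum y)).hasSum h2
    rw [hGq, h1]
    have : C n * (1 - 1 / 4)⁻¹ ≤ 2 * C n := by
      norm_num; linarith [hC0 n]
    linarith
  have hpd : ContDiff ℝ 1 p := by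
    refine contDiff_tsum (N := 1) (v := fun k n ↦ if k = 0 then C n else c * K * (1 / 2) ^ n)
      hqd ?_ ?_
    · intro k _
      by_cases h : k = 0
      · simpa [h] using hCsum.summable
      · simpa [h] using hDsum.summable
    · intro k n y hk
      have hk' : k ≤ 1 := by exact_mod_cast hk
      interval_cases k
      · simpa [abs_of_nonneg (hq0 n y)] using hqC n y
      · simpa [norm_iteratedFDeriv_one] using hqf n y
  refine ⟨p, hpd, fun y ↦ tsum_nonneg fun n ↦ hq0 n y, fun y ↦ ?_, fun y ↦ ?_, z, fun y ↦ ?_⟩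
  · have h := hupp 0 y
    have h0 : G 0 y = f y := rfl
    have h1 : C 0 = c := by simp [C]
    rw [h0, h1] at h
    nlinarith
  · rw [hp, fderiv_tsum hDsum.summable (fun n ↦ (hqd n).differentiable one_ne_zero) hqf (hqsum y)]
    refine (tsum_of_norm_bounded hDsum fun n ↦ hqf n y).trans ?_
    norm_num
    nlinarith
  -- The points `x n` maximize `f + p` up to `3 * C n`; upper semicontinuity carries this to their
  -- limit `z`.
  · by_contra! h
    obtain ⟨t, ht1, ht2⟩ := exists_between h
    have husc : UpperSemicontinuousAt (fun y ↦ f y + p y) z :=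
      UpperSemicontinuousAt.add (hf z) hpd.continuous.continuousAt.upperSemicontinuousAt
    have hev := hz.eventually (husc t ht1)
    have hC : Tendsto (fun n ↦ t + 3 * C n) atTop (𝓝 t) := by
      simpa using (hCsum.summable.tendsto_atTop_zero.const_mul 3).const_add t
    have : f y + p y ≤ t := ge_of_tendsto hC (hev.mono fun n hn ↦ by
      linarith [hupp n y, hx n y, hlow n (x n), hC0 n])
    linarith

/-! ### Semicontinuous envelopes and their local character. -/

section Envelopes

variable {S : Type*} [TopologicalSpace S] {u v s : S → ℝ}

theorem bddBelow_continuous_majorants (u : S → ℝ) (x : S) :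
    BddBelow {t : ℝ | ∃ v : S → ℝ, Continuous v ∧ (∀ y, u y ≤ v y) ∧ v x = t} := by
  refine ⟨u x, ?_⟩
  rintro _ ⟨v, -, h, rfl⟩
  exact h x

theorem upperEnvelope_le (hv : Continuous v) (h : ∀ y, u y ≤ v y) (x : S) :
    upperEnvelope u x ≤ v x :=
  csInf_le (bddBelow_continuous_majorants u x) ⟨v, hv, h, rfl⟩

theorem le_upperEnvelope (hs : Continuous s) (h : ∀ y, u y ≤ s y) (x : S) :
    u x ≤ upperEnvelope u x := by
  refine le_csInf ⟨_, s, hs, h, rfl⟩ ?_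
  rintro _ ⟨v, -, hv, rfl⟩
  exact hv x

theorem upperSemicontinuous_upperEnvelope (hs : Continuous s) (h : ∀ y, u y ≤ s y) :
    UpperSemicontinuous (upperEnvelope u) := by
  intro x t ht
  have hne : {t : ℝ | ∃ v : S → ℝ, Continuous v ∧ (∀ y, u y ≤ v y) ∧ v x = t}.Nonempty :=
    ⟨_, s, hs, h, rfl⟩
  obtain ⟨_, ⟨v, hv, huv, rfl⟩, hvt⟩ := exists_lt_of_csInf_lt hne ht
  filter_upwards [hv.continuousAt.eventually (gt_mem_nhds hvt)] with y hy
  exact (upperEnvelope_le hv huv y).trans_lt hy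

/-- The envelope is defined by global continuous majorants. Complete regularity makes it local: a
separating function interpolates between `min s t` at `x` and `s` off the neighbourhood. -/
theorem upperEnvelope_le_of_eventually_le_const [CompletelyRegularSpace S] (hs : Continuous s)
    (h : ∀ y, u y ≤ s y) {x : S} {t : ℝ} (ht : ∀ᶠ y in 𝓝 x, u y ≤ t) :
    upperEnvelope u x ≤ t := by
  obtain ⟨W, hW, hWo, hxW⟩ := eventually_nhds_iff.1 ht
  obtain ⟨φ, hφ, hφx, hφW⟩ := CompletelyRegularSpace.completely_regular x Wᶜ hWo.isClosed_compl
    (fun hx ↦ hx hxW)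
  refine (upperEnvelope_le (v := fun y ↦ min (s y) t + φ y * (s y - min (s y) t)) ?_ ?_ x).trans ?_
  · have := hφ.subtype_val
    fun_prop
  · intro y
    by_cases hy : y ∈ W
    · have h1 : u y ≤ min (s y) t := le_min (h y) (hW y hy)
      have h2 : 0 ≤ (φ y : ℝ) * (s y - min (s y) t) :=
        mul_nonneg (φ y).2.1 (sub_nonneg.2 (min_le_left _ _))
      linarith
    · have := hφW hy
      simp [this, h y]
  · simp [hφx]

theorem upperEnvelope_le_of_eventually_le [CompletelyRegularSpace S] (hs : Continuous s)
    (h : ∀ y, u y ≤ s y) {x : S} (hv : ContinuousAt v x) (huv : ∀ᶠ y in 𝓝 x, u y ≤ v y) :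
    upperEnvelope u x ≤ v x := by
  refine le_of_forall_gt fun t ht ↦ ?_
  obtain ⟨t', h1, h2⟩ := exists_between ht
  refine lt_of_le_of_lt (upperEnvelope_le_of_eventually_le_const hs h ?_) h2
  filter_upwards [huv, hv.eventually (gt_mem_nhds h1)] with y hy hy'
  exact hy.trans hy'.le

theorem lowerEnvelope_eq_neg_upperEnvelope_neg (u : S → ℝ) (x : S) :
    lowerEnvelope u x = -upperEnvelope (-u) x := by
  rw [lowerEnvelope, upperEnvelope, Real.sInf_def, neg_neg]
  congr 1
  ext t
  constructor
  · rintro ⟨v, hv, h, rfl⟩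
    exact ⟨-v, hv.neg, fun y ↦ neg_le_neg (h y), rfl⟩
  · rintro ⟨v, hv, h, hx⟩
    exact ⟨-v, hv.neg, fun y ↦ neg_le.1 (h y), by simp [hx]⟩

theorem le_lowerEnvelope (hv : Continuous v) (h : ∀ y, v y ≤ u y) (x : S) :
    v x ≤ lowerEnvelope u x := by
  rw [lowerEnvelope_eq_neg_upperEnvelope_neg, le_neg]
  exact upperEnvelope_le hv.neg (fun y ↦ neg_le_neg (h y)) x

theorem lowerEnvelope_le (hs : Continuous s) (h : ∀ y, s y ≤ u y) (x : S) :
    lowerEnvelope u x ≤ u x := by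
  rw [lowerEnvelope_eq_neg_upperEnvelope_neg, neg_le]
  exact le_upperEnvelope (u := -u) hs.neg (fun y ↦ neg_le_neg (h y)) x

theorem lowerSemicontinuous_lowerEnvelope (hs : Continuous s) (h : ∀ y, s y ≤ u y) :
    LowerSemicontinuous (lowerEnvelope u) := by
  intro x t ht
  change t < _ at ht
  rw [lowerEnvelope_eq_neg_upperEnvelope_neg, lt_neg] at ht
  filter_upwards [upperSemicontinuous_upperEnvelope (u := -u) hs.neg
    (fun y ↦ neg_le_neg (h y)) x _ ht] with y hy
  change t < _
  rwa [lowerEnvelope_eq_neg_upperEnvelope_neg, lt_neg]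

theorem le_lowerEnvelope_of_eventually_le [CompletelyRegularSpace S] (hs : Continuous s)
    (h : ∀ y, s y ≤ u y) {x : S} (hv : ContinuousAt v x) (huv : ∀ᶠ y in 𝓝 x, v y ≤ u y) :
    v x ≤ lowerEnvelope u x := by
  rw [lowerEnvelope_eq_neg_upperEnvelope_neg, le_neg]
  exact upperEnvelope_le_of_eventually_le (u := -u) hs.neg (fun y ↦ neg_le_neg (h y)) hv.neg
    (huv.mono fun y ↦ neg_le_neg)

end Envelopes

/-! ### Charts, cutoffs and covectors in coordinates. -/

/-- In a regular space, small closed balls of a chart are closed. -/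
theorem OpenPartialHomeomorph.exists_isClosed_symm_image_closedBall {M X : Type*}
    [TopologicalSpace M] [RegularSpace M] [PseudoMetricSpace X] (e : OpenPartialHomeomorph M X)
    {y : M} (hy : y ∈ e.source) {V : Set M} (hV : V ∈ 𝓝 y) :
    ∃ R > 0, Metric.closedBall (e y) R ⊆ e.target ∧ e.symm '' Metric.closedBall (e y) R ⊆ V ∧
      ∀ r ≤ R, IsClosed (e.symm '' Metric.closedBall (e y) r) := by
  obtain ⟨C, hC, hCc, hCV⟩ := exists_mem_nhds_isClosed_subset
    (inter_mem hV (e.open_source.mem_nhds hy))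
  have h1 : e.target ∩ e.symm ⁻¹' C ∈ 𝓝 (e y) :=
    inter_mem (e.open_target.mem_nhds (e.map_source hy))
      ((e.continuousAt_symm (e.map_source hy)).preimage_mem_nhds (by rwa [e.left_inv hy]))
  obtain ⟨R, hR, hRs⟩ := Metric.nhds_basis_closedBall.mem_iff.1 h1
  refine ⟨R, hR, fun z hz ↦ (hRs hz).1, ?_, fun r hr ↦ ?_⟩
  · rintro _ ⟨z, hz, rfl⟩
    exact (hCV (hRs hz).2).1
  -- A preimage under `e` is closed only relative to the chart domain; intersecting with a closed
  -- `C` inside the domain makes it closed in `M`.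
  · have : e.symm '' Metric.closedBall (e y) r = C ∩ e ⁻¹' Metric.closedBall (e y) r := by
      ext z
      constructor
      · rintro ⟨q, hq, rfl⟩
        have := hRs (Metric.closedBall_subset_closedBall hr hq)
        exact ⟨this.2, by rwa [mem_preimage, e.right_inv this.1]⟩
      · rintro ⟨hz, hz'⟩
        exact ⟨e z, hz', e.left_inv (hCV hz).2⟩
    rw [this]
    exact (e.continuousOn.mono fun z hz ↦ (hCV hz).2).preimage_isClosed_of_isClosed hCc
      Metric.isClosed_closedBall

section Charts

variable {X : Type*} [NormedAddCommGroup X] [NormedSpace ℝ X]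
variable {M : Type*} [TopologicalSpace M] [ChartedSpace X M] [IsManifold 𝓘(ℝ, X) 1 M]

theorem contMDiffAt_comp_chartAt {x y : M} (hy : y ∈ (chartAt X x).source) {κ : X → ℝ}
    (hκ : ContDiffAt ℝ 1 κ (chartAt X x y)) :
    ContMDiffAt 𝓘(ℝ, X) 𝓘(ℝ, ℝ) 1 (fun z ↦ κ (chartAt X x z)) y :=
  hκ.contMDiffAt.comp y
    (contMDiffAt_of_mem_maximalAtlas (IsManifold.chart_mem_maximalAtlas x) hy)

theorem HasC1LipschitzBump.exists_cutoff [RegularSpace M] (hX : HasC1LipschitzBump X) {y : M}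
    {V : Set M} (hV : V ∈ 𝓝 y) :
    ∃ β : M → ℝ, ContMDiff 𝓘(ℝ, X) 𝓘(ℝ, ℝ) 1 β ∧ (∀ᶠ z in 𝓝 y, β z = 1) ∧ tsupport β ⊆ V := by
  set e := chartAt X y
  have hy : y ∈ e.source := mem_chart_source X y
  obtain ⟨R, hR, hRt, hRV, hRc⟩ := e.exists_isClosed_symm_image_closedBall hy hV
  obtain ⟨K, -, hK⟩ := hX.exists_scaled
  obtain ⟨b, hb, -, -, -, hb1, hbR⟩ := hK (e y) R hR
  have hsupp : tsupport (e.source.indicator (b ∘ e)) ⊆ e.symm '' Metric.closedBall (e y) R := by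
    refine closure_minimal (fun z hz ↦ ?_) (hRc R le_rfl)
    have hzs : z ∈ e.source := mem_of_indicator_ne_zero hz
    rw [Function.mem_support, indicator_of_mem hzs] at hz
    refine ⟨e z, ?_, e.left_inv hzs⟩
    by_contra h
    exact hz (hbR _ (not_le.1 h).le)
  refine ⟨e.source.indicator (b ∘ e), contMDiff_of_tsupport fun z hz ↦ ?_, ?_, hsupp.trans hRV⟩
  · obtain ⟨q, hq, rfl⟩ := hsupp hz
    have hz' := e.map_target (hRt hq)
    refine (contMDiffAt_comp_chartAt hz' hb.contDiffAt).congr_of_eventuallyEq ?_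
    filter_upwards [e.open_source.mem_nhds hz'] with z hz
    simp [indicator_of_mem hz, e]
  · filter_upwards [e.open_source.mem_nhds hy, (e.continuousAt hy).eventually hb1] with z hz hz1
    simpa [indicator_of_mem hz] using hz1

/-- The covector at `y` given by `A` in the coordinates of the chart at `x`. -/
noncomputable def chartCovector (x y : M) (A : X →L[ℝ] ℝ) : TangentSpace 𝓘(ℝ, X) y →L[ℝ] ℝ :=
  A ∘L (trivializationAt X (TangentSpace 𝓘(ℝ, X)) x).continuousLinearMapAt ℝ y

theorem mvfderiv_eq_chartCovector {x y : M} (hy : y ∈ (chartAt X x).source) {κ : X → ℝ}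
    {g : M → ℝ} (hg : ∀ᶠ z in 𝓝 y, g z = κ (chartAt X x z))
    (hκ : DifferentiableAt ℝ κ (chartAt X x y)) :
    mvfderiv 𝓘(ℝ, X) g y = chartCovector x y (fderiv ℝ κ (chartAt X x y)) := by
  have h1 : mfderiv 𝓘(ℝ, X) 𝓘(ℝ, ℝ) g y
      = mfderiv 𝓘(ℝ, X) 𝓘(ℝ, ℝ) (κ ∘ extChartAt 𝓘(ℝ, X) x) y := by
    apply Filter.EventuallyEq.mfderiv_eq
    filter_upwards [hg] with z hz
    simpa using hz
  have h2 := mfderiv_comp (I := 𝓘(ℝ, X)) (I' := 𝓘(ℝ, X)) (I'' := 𝓘(ℝ, ℝ)) y (g := κ)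
    (f := extChartAt 𝓘(ℝ, X) x)
    (by simpa using hκ.mdifferentiableAt) (mdifferentiableAt_extChartAt hy)
  rw [mvfderiv, h1, h2, chartCovector, TangentBundle.continuousLinearMapAt_trivializationAt hy,
    mfderiv_eq_fderiv]
  ext v
  simp
  rfl

/-- Superdifferentials are tested by functions that are `C¹` on all of `M`. A cutoff equal to `1`
near `y` globalizes a test function living in a chart without changing its germ at `y`. -/
theorem mem_superdifferential_of_chart [RegularSpace M] (hX : HasC1LipschitzBump X)
    {Ω : TopologicalSpace.Opens M} {w : Ω → ℝ} {x : M} {y : Ω}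
    (hy : (y : M) ∈ (chartAt X x).source) {κ : X → ℝ} (hκ : ContDiffAt ℝ 1 κ (chartAt X x y))
    (hmax : IsLocalMax (fun z : Ω ↦ w z - κ (chartAt X x z)) y) :
    chartCovector x y (fderiv ℝ κ (chartAt X x y)) ∈ superdifferential (X := X) w y := by
  set e := chartAt X x
  have hV : ∀ᶠ z in 𝓝 (y : M), z ∈ e.source ∧ ContDiffAt ℝ 1 κ (e z) :=
    Filter.Eventually.and (e.open_source.mem_nhds hy) ((e.continuousAt hy).eventually (hκ.eventually (by simp)))
  obtain ⟨β, hβ, hβ1, hβV⟩ := hX.exists_cutoff hV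
  have heq : ∀ᶠ z in 𝓝 (y : M), β z * κ (e z) = κ (e z) := hβ1.mono fun z hz ↦ by simp [hz]
  refine ⟨fun z ↦ β z * κ (e z), contMDiff_of_tsupport fun z hz ↦ ?_, ?_,
    mvfderiv_eq_chartCovector hy heq (hκ.differentiableAt one_ne_zero)⟩
  · have hz' := hβV (closure_mono (Function.support_mul_subset_left _ _) hz)
    exact hβ.contMDiffAt.mul (contMDiffAt_comp_chartAt hz'.1 hz'.2)
  · refine hmax.congr ?_
    filter_upwards [continuous_subtype_val.continuousAt.eventually heq] with z hz
    simp [hz]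

/-- In the trivialization at `x`, the point `chartCovector x y A` has fibre coordinate exactly `A`.
-/
theorem continuousAt_covectorAt_chartCovector {Ω : TopologicalSpace.Opens M} (x : Ω)
    (A : X →L[ℝ] ℝ) :
    ContinuousAt (fun q : Ω × (X →L[ℝ] ℝ) ↦ covectorAt q.1 (chartCovector (x : M) q.1 q.2))
      (x, A) := by
  refine Topology.IsInducing.subtypeVal.continuousAt_iff.2 ?_
  refine (continuousAt_hom_bundle (RingHom.id ℝ) _).2 ⟨?_, ?_⟩
  · exact (continuous_subtype_val.comp continuous_fst).continuousAt
  · refine continuousAt_snd.congr ?_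
    have hx : (x : M) ∈ (trivializationAt X (TangentSpace 𝓘(ℝ, X)) (x : M)).baseSet :=
      mem_baseSet_trivializationAt X _ _
    have : ∀ᶠ q : Ω × (X →L[ℝ] ℝ) in 𝓝 (x, A),
        (q.1 : M) ∈ (trivializationAt X (TangentSpace 𝓘(ℝ, X)) (x : M)).baseSet :=
      (continuous_subtype_val.comp continuous_fst).continuousAt.eventually
        ((trivializationAt X (TangentSpace 𝓘(ℝ, X)) (x : M)).open_baseSet.mem_nhds hx)
    filter_upwards [this] with q hq
    ext v
    simp [ContinuousLinearMap.inCoordinates, covectorAt, chartCovector,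
      Trivialization.continuousLinearMapAt_symmL _ hq]

end Charts

/-! ### Transfer to chart balls and local comparison. -/

section Viscosity

variable {M : Type*} [TopologicalSpace M] {Ω : TopologicalSpace.Opens M}

theorem TopologicalSpace.Opens.eventually_nhds_coe {x : Ω} {P : Ω → Prop}
    (hP : ∀ᶠ y in 𝓝 x, P y) : ∀ᶠ m in 𝓝 (x : M), ∃ h : m ∈ Ω, P ⟨m, h⟩ := by
  rw [← map_nhds_subtype_coe_eq_nhds x.2 (Ω.isOpen.mem_nhds x.2)]
  exact hP.mono fun y hy ↦ ⟨y.2, hy⟩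

theorem exists_chart_closedBall {X : Type*} [PseudoMetricSpace X] [ChartedSpace X M]
    [RegularSpace M] (x : Ω) {P : Ω → Prop} (hP : ∀ᶠ y in 𝓝 x, P y)
    {Q : X → Prop} (hQ : ∀ᶠ z in 𝓝 (chartAt X (x : M) x), Q z) :
    ∃ R > 0, Metric.closedBall (chartAt X (x : M) x) R ⊆ (chartAt X (x : M)).target ∧
      (∀ r ≤ R, IsClosed ((chartAt X (x : M)).symm '' Metric.closedBall (chartAt X (x : M) x) r)) ∧
      (∀ z ∈ Metric.closedBall (chartAt X (x : M) x) R, (chartAt X (x : M)).symm z ∈ Ω) ∧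
      (∀ y : Ω, (y : M) ∈ (chartAt X (x : M)).source →
        chartAt X (x : M) y ∈ Metric.closedBall (chartAt X (x : M) x) R → P y) ∧
      ∀ z ∈ Metric.closedBall (chartAt X (x : M) x) R, Q z := by
  set e := chartAt X (x : M)
  have hx : (x : M) ∈ e.source := mem_chart_source X _
  obtain ⟨R, hR, hRt, hRV, hRc⟩ := e.exists_isClosed_symm_image_closedBall hx
    (Filter.Eventually.and (TopologicalSpace.Opens.eventually_nhds_coe hP)
      ((e.continuousAt hx).eventually hQ))
  refine ⟨R, hR, hRt, hRc, fun z hz ↦ ?_, fun y hy hyR ↦ ?_, fun z hz ↦ ?_⟩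
  · exact (hRV ⟨z, hz, rfl⟩).1.1
  · exact (hRV ⟨e y, hyR, e.left_inv hy⟩).1.2
  · have := (hRV ⟨z, hz, rfl⟩).2
    rwa [e.right_inv (hRt hz)] at this

variable {X : Type*} [NormedAddCommGroup X] [NormedSpace ℝ X] [ChartedSpace X M]
  [IsManifold 𝓘(ℝ, X) 1 M]

theorem contDiffAt_comp_chartAt_symm {g : M → ℝ} (hg : ContMDiff 𝓘(ℝ, X) 𝓘(ℝ, ℝ) 1 g) (x : M)
    {z : X} (hz : z ∈ (chartAt X x).target) :
    ContDiffAt ℝ 1 (fun z ↦ g ((chartAt X x).symm z)) z := by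
  rw [← contMDiffAt_iff_contDiffAt]
  exact hg.contMDiffAt.comp z ((contMDiffOn_chart_symm z hz).contMDiffAt
    ((chartAt X x).open_target.mem_nhds hz))

theorem mvfderiv_eq_chartCovector_symm {g : M → ℝ} (hg : ContMDiff 𝓘(ℝ, X) 𝓘(ℝ, ℝ) 1 g)
    {x y : M} (hy : y ∈ (chartAt X x).source) (c : ℝ) :
    mvfderiv 𝓘(ℝ, X) g y = chartCovector x y
      (fderiv ℝ (fun z ↦ g ((chartAt X x).symm z) + c) (chartAt X x y)) := by
  rw [fderiv_add_const]
  refine mvfderiv_eq_chartCovector hy ?_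
    ((contDiffAt_comp_chartAt_symm hg x ((chartAt X x).map_source hy)).differentiableAt one_ne_zero)
  filter_upwards [(chartAt X x).open_source.mem_nhds hy] with z hz
  rw [(chartAt X x).left_inv hz]

/-- Continuity of `F` in the form used later: a strict sign at one point persists with a single
tolerance `η` for covectors and values, over a whole neighbourhood of the base point. -/
theorem exists_forall_chartCovector_mem {F : CotangentBundleOver X Ω × ℝ → ℝ} (hF : Continuous F)
    {x : Ω} {A₀ : X →L[ℝ] ℝ} {t₀ : ℝ} {U : Set ℝ} (hU : IsOpen U)
    (h : F (covectorAt x (chartCovector (x : M) x A₀), t₀) ∈ U) :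
    ∃ η > 0, ∀ᶠ y in 𝓝 x, ∀ A, ‖A - A₀‖ < η → ∀ t, |t - t₀| < η →
      F (covectorAt y (chartCovector (x : M) y A), t) ∈ U := by
  have h1 : ContinuousAt (fun q : Ω × (X →L[ℝ] ℝ) × ℝ ↦
      F (covectorAt q.1 (chartCovector (x : M) q.1 q.2.1), q.2.2)) (x, A₀, t₀) := by
    refine hF.continuousAt.comp (ContinuousAt.prodMk ?_ (by fun_prop))
    have h0 : Tendsto (fun q : Ω × (X →L[ℝ] ℝ) × ℝ ↦ (q.1, q.2.1)) (𝓝 (x, A₀, t₀))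
        (𝓝 (x, A₀)) := Continuous.tendsto (by fun_prop) (x, A₀, t₀)
    exact (continuousAt_covectorAt_chartCovector x A₀).tendsto.comp h0
  have h2 := h1.eventually (hU.mem_nhds h)
  rw [nhds_prod_eq] at h2
  obtain ⟨P, hP, Q, hQ, hPQ⟩ := eventually_prod_iff.1 h2
  obtain ⟨η, hη, hηQ⟩ := Metric.eventually_nhds_iff.1 hQ
  refine ⟨η, hη, hP.mono fun y hy A hA t ht ↦ ?_⟩
  refine hPQ (y := (A, t)) hy (hηQ ?_)
  rw [Prod.dist_eq, max_lt_iff]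
  exact ⟨by rwa [dist_eq_norm], by rwa [Real.dist_eq]⟩

/-- A comparison principle on a chart ball, between a subsolution `w` and a function `h` which is
a strict supersolution, robustly under small perturbations. -/
theorem IsViscositySubsolution.le_on_chart_ball [RegularSpace M] [CompleteSpace X]
    (hX : HasC1LipschitzBump X) {F : CotangentBundleOver X Ω × ℝ → ℝ} {w : Ω → ℝ}
    (hw : IsViscositySubsolution F w) {x : M} {a : X} {R R' δ C : ℝ} (hδ : 0 < δ) (hRR : R' < R)
    (hball : Metric.ball a R ⊆ (chartAt X x).target)
    (hΩ : ∀ z ∈ Metric.ball a R, (chartAt X x).symm z ∈ Ω) {h : X → ℝ}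
    (hh : ∀ z ∈ Metric.ball a R, ContDiffAt ℝ 1 h z)
    (hbdd : ∀ y : Ω, (y : M) ∈ (chartAt X x).source → chartAt X x y ∈ Metric.ball a R →
      w y ≤ h (chartAt X x y) + C)
    (hgap : ∀ y : Ω, (y : M) ∈ (chartAt X x).source → chartAt X x y ∈ Metric.ball a R →
      chartAt X x y ∉ Metric.closedBall a R' → w y ≤ h (chartAt X x y) - δ)
    (hF : ∀ y : Ω, (y : M) ∈ (chartAt X x).source → chartAt X x y ∈ Metric.ball a R →
      h (chartAt X x y) - δ < w y → ∀ A, ‖A - fderiv ℝ h (chartAt X x y)‖ ≤ δ →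
      0 < F (covectorAt y (chartCovector x y A), w y))
    {y : Ω} (hy : (y : M) ∈ (chartAt X x).source) (hyR : chartAt X x y ∈ Metric.ball a R) :
    w y ≤ h (chartAt X x y) := by
  classical
  set e := chartAt X x
  by_contra! hlt
  -- The default value `0` off `Ω` plays no role, since the ball is sent into `Ω`.
  set W : M → ℝ := Function.extend Subtype.val w 0
  have hW : ∀ y : Ω, W y = w y := fun y ↦ Subtype.val_injective.extend_apply _ _ _
  -- By `hgap` the truncation already equals `-δ` outside the smaller ball, so the extension by `-δ`
  -- is upper semicontinuous on all of `X`.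
  set f : X → ℝ := fun z ↦ if z ∈ Metric.ball a R then max (W (e.symm z) - h z) (-δ) else -δ
    with hf
  have hfy : ∀ y : Ω, (y : M) ∈ e.source → e y ∈ Metric.ball a R →
      f (e y) = max (w y - h (e y)) (-δ) := by
    intro y hy hyR
    simp only [hf, if_pos hyR, e.left_inv hy, hW]
  have hfn : ∀ z ∉ Metric.ball a R, f z = -δ := fun z hz ↦ if_neg hz
  have hlift : ∀ z ∈ Metric.ball a R, ∃ y : Ω, (y : M) ∈ e.source ∧ e y = z := fun z hz ↦
    ⟨⟨e.symm z, hΩ z hz⟩, e.map_target (hball hz), e.right_inv (hball hz)⟩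
  have husc : UpperSemicontinuous f := by
    intro z t ht
    change f z < t at ht
    change ∀ᶠ z' in 𝓝 z, f z' < t
    by_cases hz : z ∈ Metric.ball a R
    · obtain ⟨y, hys, rfl⟩ := hlift z hz
      rw [hfy y hys hz, max_lt_iff] at ht
      obtain ⟨t₁, h1, h2⟩ := exists_between (show w y < t + h (e y) by linarith [ht.1])
      have hw1 := TopologicalSpace.Opens.eventually_nhds_coe (hw.1 y t₁ h1)
      have hce := e.continuousAt_symm (hball hz)
      rw [ContinuousAt, e.left_inv hys] at hce
      have hh1 : ∀ᶠ z' in 𝓝 (e y), t₁ - t < h z' :=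
        (hh _ hz).continuousAt.eventually (lt_mem_nhds (by linarith))
      filter_upwards [hce.eventually hw1, hh1, Metric.isOpen_ball.mem_nhds hz]
        with z' ⟨h3, h4⟩ h5 h6
      simp only [hf, if_pos h6]
      have : W (e.symm z') < t₁ := by rw [hW ⟨_, h3⟩]; exact h4
      exact max_lt (by linarith) ht.2
    · have hz' : z ∈ (Metric.closedBall a R')ᶜ := fun hz' ↦
        hz (Metric.closedBall_subset_ball hRR hz')
      have ht' : -δ < t := by rwa [hfn z hz] at ht
      filter_upwards [Metric.isClosed_closedBall.isOpen_compl.mem_nhds hz'] with z' h1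
      by_cases h2 : z' ∈ Metric.ball a R
      · obtain ⟨y, hys, rfl⟩ := hlift z' h2
        rw [hfy y hys h2]
        exact max_lt (by linarith [hgap y hys h2 h1]) ht'
      · rwa [hfn z' h2]
  have hfb : BddAbove (range f) := by
    refine ⟨max C (-δ), ?_⟩
    rintro _ ⟨z, rfl⟩
    by_cases hz : z ∈ Metric.ball a R
    · obtain ⟨y, hys, rfl⟩ := hlift z hz
      rw [hfy y hys hz]
      exact max_le_max_right _ (by linarith [hbdd y hys hz])
    · rw [hfn z hz]
      exact le_max_right _ _
  obtain ⟨p, hp, hp0, hpδ, hp', z, hz⟩ := hX.exists_perturbation_isMax husc hfb hδ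
  -- The perturbation takes values in `[0, δ]` and `f` is positive at `e y`. The maximum therefore
  -- exceeds the floor `-δ`, so it lies in the ball and the truncation is inactive there.
  have hfz : -δ < f z := by
    have h1 := hz (e y)
    rw [hfy y hy hyR] at h1
    linarith [le_max_left (w y - h (e y)) (-δ), hp0 (e y), hpδ z]
  have hzR : z ∈ Metric.ball a R := by
    by_contra hzR
    exact hfz.ne' (hfn z hzR)
  obtain ⟨y', hys, rfl⟩ := hlift z hzR
  rw [hfy y' hys hzR, lt_max_iff, or_iff_left (lt_irrefl _)] at hfz
  have hmax : IsLocalMax (fun q : Ω ↦ w q - (h (e q) - p (e q))) y' := by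
    have hn : ∀ᶠ q : Ω in 𝓝 y', (q : M) ∈ e.source ∧ e q ∈ Metric.ball a R :=
      continuous_subtype_val.continuousAt.eventually (Filter.Eventually.and
        (e.open_source.mem_nhds hys)
        ((e.continuousAt hys).eventually (Metric.isOpen_ball.mem_nhds hzR)))
    filter_upwards [hn] with q hq
    have h1 := hz (e q)
    rw [hfy q hq.1 hq.2, hfy y' hys hzR, max_eq_left hfz.le] at h1
    linarith [le_max_left (w q - h (e q)) (-δ)]
  have hmem := mem_superdifferential_of_chart hX (κ := fun z ↦ h z - p z) hys
    ((hh _ hzR).sub hp.contDiffAt) hmax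
  refine (hF y' hys hzR (by linarith) _ ?_).not_ge (hw.2 y' _ hmem)
  rw [fderiv_fun_sub ((hh _ hzR).differentiableAt one_ne_zero) (hp.differentiable one_ne_zero _)]
  simpa using hp' (e y')

end Viscosity

/-! ### The two halves of Perron's method. -/

section Perron

variable {X : Type*} [NormedAddCommGroup X] [NormedSpace ℝ X]
variable {M : Type*} [TopologicalSpace M] [ChartedSpace X M] [IsManifold 𝓘(ℝ, X) 1 M]
variable {Ω : TopologicalSpace.Opens M}

theorem isViscositySubsolution_upperEnvelope [CompletelyRegularSpace M] [CompleteSpace X]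
    (hX : HasC1LipschitzBump X) {F : CotangentBundleOver X Ω × ℝ → ℝ} (hF : Continuous F)
    {𝒲 : Set (Ω → ℝ)} (h𝒲 : ∀ w ∈ 𝒲, IsViscositySubsolution F w) {u s : Ω → ℝ}
    (hu : ∀ x, IsLUB ((fun w : Ω → ℝ ↦ w x) '' 𝒲) (u x)) (hs : Continuous s)
    (hus : ∀ x, u x ≤ s x) :
    IsViscositySubsolution F (upperEnvelope u) := by
  refine ⟨upperSemicontinuous_upperEnvelope hs hus, ?_⟩
  rintro x _ ⟨g, hg, hmax, rfl⟩
  by_contra! hpos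
  set e := chartAt X (x : M)
  have hxs : (x : M) ∈ e.source := mem_chart_source X _
  set t₀ := upperEnvelope u x
  -- The test function in coordinates, shifted so that it touches the envelope at `x`.
  set κ : X → ℝ := fun z ↦ g (e.symm z) + (t₀ - g x) with hκ
  have hκe : ∀ y ∈ e.source, κ (e y) = g y + (t₀ - g x) := fun y hy ↦ by
    simp only [hκ, e.left_inv hy]
  have hκx : κ (e x) = t₀ := by rw [hκe x hxs]; ring
  have hκd : ∀ z ∈ e.target, ContDiffAt ℝ 1 κ z := fun z hz ↦
    (contDiffAt_comp_chartAt_symm hg x hz).add contDiffAt_const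
  rw [mvfderiv_eq_chartCovector_symm hg hxs (t₀ - g x)] at hpos
  obtain ⟨η, hη, hηF⟩ := exists_forall_chartCovector_mem hF isOpen_Ioi hpos
  have hex : e x ∈ e.target := e.map_source hxs
  have hle : ∀ᶠ y : Ω in 𝓝 x, (y : M) ∈ e.source → upperEnvelope u y ≤ κ (e y) := by
    filter_upwards [hmax] with y hy hys
    rw [hκe y hys]
    linarith
  have hQ : ∀ᶠ z in 𝓝 (e x), ‖fderiv ℝ κ z - fderiv ℝ κ (e x)‖ < η / 3 ∧ |κ z - t₀| < η / 3 := by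
    have h1 := ((hκd _ hex).fderiv_right (m := 0) (by simp)).continuousAt
    have h2 := (hκd _ hex).continuousAt
    refine (h1.eventually (Metric.ball_mem_nhds _ (by positivity : 0 < η / 3))).and
      (h2.eventually (Metric.ball_mem_nhds _ (by positivity : 0 < η / 3))) |>.mono ?_
    intro z hz
    rwa [dist_eq_norm, Real.dist_eq, hκx] at hz
  obtain ⟨R, hR, hRt, -, hRΩ, hRP, hRQ⟩ := exists_chart_closedBall x (hηF.and hle) hQ
  obtain ⟨K, hK0, hK⟩ := hX.exists_scaled
  obtain ⟨b, hb, hb', hb0, hb1, hba, hbR⟩ := hK (e x) (R / 2) (by positivity)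
  set L := K / (R / 2)
  have hL : 0 ≤ L := by positivity
  -- This bounds both `2 * δ * L`, the gradient cost of the bump, and `2 * δ`, the cost in values,
  -- by `η / 3`.
  obtain ⟨δ, hδ, hδL⟩ : ∃ δ > 0, 2 * δ * (L + 1) = η / 3 :=
    ⟨η / (6 * (L + 1)), by positivity, by field_simp; norm_num⟩
  have hδη : 2 * δ ≤ η / 3 := by nlinarith
  -- Equal to `κ + δ` off the half ball, which provides the gap for comparison, and to `κ - δ` near
  -- `x`, which contradicts contact at `x`.
  set h : X → ℝ := fun z ↦ κ z + δ * (1 - 2 * b z) with hh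
  have hsub := Metric.ball_subset_closedBall (x := e x) (ε := R)
  have hwκ : ∀ w ∈ 𝒲, ∀ y : Ω, (y : M) ∈ e.source → e y ∈ Metric.ball (e x) R →
      w y ≤ κ (e y) := fun w hw y hys hyR ↦
    ((hu y).1 ⟨w, hw, rfl⟩).trans ((le_upperEnvelope hs hus y).trans
      ((hRP y hys (hsub hyR)).2 hys))
  have hhd : ∀ z ∈ e.target, ContDiffAt ℝ 1 h z := fun z hz ↦
    (hκd z hz).add (contDiffAt_const.mul (contDiffAt_const.sub
      (contDiffAt_const.mul hb.contDiffAt)))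
  have hh' : ∀ z ∈ e.target, ‖fderiv ℝ h z - fderiv ℝ κ z‖ ≤ 2 * δ * L := by
    intro z hz
    have h1 : HasFDerivAt h (fderiv ℝ κ z + δ • -((2 : ℝ) • fderiv ℝ b z)) z :=
      ((hκd z hz).differentiableAt one_ne_zero).hasFDerivAt.add
        ((((hb.differentiable one_ne_zero z).hasFDerivAt.const_mul 2).const_sub 1).const_mul δ)
    rw [h1.fderiv, add_sub_cancel_left, norm_smul, norm_neg, norm_smul, Real.norm_of_nonneg hδ.le,
      Real.norm_two]
    nlinarith [hb' z]
  have hwh : ∀ w ∈ 𝒲, ∀ y : Ω, (y : M) ∈ e.source → e y ∈ Metric.ball (e x) R →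
      w y ≤ h (e y) := by
    intro w hw y hys hyR
    refine (h𝒲 w hw).le_on_chart_ball hX (R' := R / 2) (C := δ) hδ (by linarith)
      (hsub.trans hRt) (fun z hz ↦ hRΩ z (hsub hz)) (fun z hz ↦ hhd z (hRt (hsub hz)))
      ?_ ?_ ?_ hys hyR
    · intro y hys hyR
      have := hwκ w hw y hys hyR
      simp only [hh]
      nlinarith [hb1 (e y)]
    · intro y hys hyR hyR'
      have := hwκ w hw y hys hyR
      simp only [hh]
      rw [hbR (e y) (not_le.1 hyR').le]
      linarith
    · intro y hys hyR hlt A hA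
      have h1 := hRQ _ (hsub hyR)
      have h2 := hh' _ (hRt (hsub hyR))
      have h3 := hwκ w hw y hys hyR
      refine (hRP y hys (hsub hyR)).1 A ?_ _ ?_
      · calc ‖A - fderiv ℝ κ (e x)‖
            = ‖(A - fderiv ℝ h (e y)) + (fderiv ℝ h (e y) - fderiv ℝ κ (e y))
              + (fderiv ℝ κ (e y) - fderiv ℝ κ (e x))‖ := by congr 1; abel
          _ ≤ _ := norm_add₃_le
          _ < η := by linarith [h1.1]
      · have h4 := abs_lt.1 h1.2
        have h5 : κ (e y) - δ ≤ h (e y) := by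
          simp only [hh]
          nlinarith [hb1 (e y)]
        rw [abs_lt]
        constructor <;> linarith
  have huh : ∀ᶠ y : Ω in 𝓝 x, u y ≤ h (e y) := by
    have hn : ∀ᶠ q : Ω in 𝓝 x, (q : M) ∈ e.source ∧ e q ∈ Metric.ball (e x) R :=
      continuous_subtype_val.continuousAt.eventually (Filter.Eventually.and
        (e.open_source.mem_nhds hxs)
        ((e.continuousAt hxs).eventually (Metric.ball_mem_nhds _ hR)))
    filter_upwards [hn] with y hy
    refine (hu y).2 ?_
    rintro _ ⟨w, hw, rfl⟩
    exact hwh w hw y hy.1 hy.2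
  have hhc : ContinuousAt (fun y : Ω ↦ h (e y)) x :=
    ContinuousAt.comp (g := h) (hhd _ hex).continuousAt
      (ContinuousAt.comp (g := e) (e.continuousAt hxs) continuous_subtype_val.continuousAt)
  have hfin := upperEnvelope_le_of_eventually_le hs hus hhc huh
  simp only [hh, hκx, hba.self_of_nhds] at hfin
  linarith

theorem isViscositySupersolution_lowerEnvelope [CompletelyRegularSpace M]
    (hX : HasC1LipschitzBump X) {F : CotangentBundleOver X Ω × ℝ → ℝ} (hF : Continuous F)
    {s₀ s₁ U : Ω → ℝ} (hs₀ : Continuous s₀) (hs₁ : Continuous s₁)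
    (hsuper : IsViscositySupersolution F s₁) (hU : U ∈ perronFamily F s₀ s₁)
    (hmaximal : ∀ w ∈ perronFamily F s₀ s₁, ∀ y, w y ≤ U y) :
    IsViscositySupersolution F (lowerEnvelope U) := by
  classical
  obtain ⟨hU₀, hU₁, hUsub⟩ := hU
  refine ⟨lowerSemicontinuous_lowerEnvelope hs₀ hU₀, ?_⟩
  rintro x _ ⟨g, hg, hmin, rfl⟩
  by_contra! hneg
  have hvU : ∀ y, lowerEnvelope U y ≤ U y := lowerEnvelope_le hs₀ hU₀
  set t₀ := lowerEnvelope U x with ht₀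
  -- Were there equality, `g` would touch `s₁` from below at `x`, and the supersolution property of
  -- `s₁` would exclude `F < 0`.
  have hlt : t₀ < s₁ x := by
    refine lt_of_le_of_ne ((hvU x).trans (hU₁ x)) fun heq ↦ hneg.not_ge ?_
    rw [heq]
    refine hsuper.2 x _ ⟨g, hg, ?_, rfl⟩
    filter_upwards [hmin] with y hy
    linarith [hvU y, hU₁ y]
  set e := chartAt X (x : M)
  have hxs : (x : M) ∈ e.source := mem_chart_source X _
  set κ : X → ℝ := fun z ↦ g (e.symm z) + (t₀ - g x) with hκ
  have hκe : ∀ y ∈ e.source, κ (e y) = g y + (t₀ - g x) := fun y hy ↦ by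
    simp only [hκ, e.left_inv hy]
  have hκx : κ (e x) = t₀ := by rw [hκe x hxs]; ring
  have hκd : ∀ z ∈ e.target, ContDiffAt ℝ 1 κ z := fun z hz ↦
    (contDiffAt_comp_chartAt_symm hg x hz).add contDiffAt_const
  rw [mvfderiv_eq_chartCovector_symm hg hxs (t₀ - g x)] at hneg
  obtain ⟨η, hη, hηF⟩ := exists_forall_chartCovector_mem hF isOpen_Iio hneg
  have hex : e x ∈ e.target := e.map_source hxs
  obtain ⟨γ, hγ, hγs⟩ : ∃ γ > 0, t₀ + γ < s₁ x :=
    ⟨(s₁ x - t₀) / 2, by linarith, by linarith⟩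
  have hev : ∀ {h : X → ℝ}, ContinuousAt h (e x) → ContinuousAt (fun y : Ω ↦ h (e y)) x :=
    fun {h} hh ↦ ContinuousAt.comp (g := h) hh
      (ContinuousAt.comp (g := e) (e.continuousAt hxs) continuous_subtype_val.continuousAt)
  have hle : ∀ᶠ y : Ω in 𝓝 x,
      ((y : M) ∈ e.source → κ (e y) ≤ lowerEnvelope U y) ∧ κ (e y) + γ < s₁ y := by
    have h1 : ∀ᶠ y : Ω in 𝓝 x, κ (e y) + γ < s₁ y :=
      ((hev (hκd _ hex).continuousAt).add continuousAt_const).eventually_lt hs₁.continuousAt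
        (by simpa [hκx] using hγs)
    filter_upwards [hmin, h1] with y hy hy1
    refine ⟨fun hys ↦ ?_, hy1⟩
    rw [hκe y hys]
    linarith
  have hQ : ∀ᶠ z in 𝓝 (e x), ‖fderiv ℝ κ z - fderiv ℝ κ (e x)‖ < η / 3 ∧ |κ z - t₀| < η / 3 := by
    have h1 := ((hκd _ hex).fderiv_right (m := 0) (by simp)).continuousAt
    have h2 := (hκd _ hex).continuousAt
    refine (h1.eventually (Metric.ball_mem_nhds _ (by positivity : 0 < η / 3))).and
      (h2.eventually (Metric.ball_mem_nhds _ (by positivity : 0 < η / 3))) |>.mono ?_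
    intro z hz
    rwa [dist_eq_norm, Real.dist_eq, hκx] at hz
  obtain ⟨R, hR, hRt, hRc, hRΩ, hRP, hRQ⟩ := exists_chart_closedBall x (hηF.and hle) hQ
  obtain ⟨K, hK0, hK⟩ := hX.exists_scaled
  obtain ⟨b, hb, hb', hb0, hb1, hba, hbR⟩ := hK (e x) (R / 2) (by positivity)
  set L := K / (R / 2)
  have hL : 0 ≤ L := by positivity
  -- `δ ≤ γ` keeps the raised function below `s₁`; the other bound keeps its values and gradients
  -- where `F < 0`.
  obtain ⟨δ, hδ, hδγ, hδL⟩ : ∃ δ > 0, δ ≤ γ ∧ δ * (L + 1) ≤ η / 3 := by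
    refine ⟨min γ (η / (3 * (L + 1))), by positivity, min_le_left _ _, ?_⟩
    calc min γ (η / (3 * (L + 1))) * (L + 1) ≤ η / (3 * (L + 1)) * (L + 1) := by
          gcongr; exact min_le_right _ _
      _ = η / 3 := by field_simp
  have hδη : δ ≤ η / 3 := by nlinarith
  set h : X → ℝ := fun z ↦ κ z + δ * b z with hh
  have hhd : ∀ z ∈ e.target, ContDiffAt ℝ 1 h z := fun z hz ↦
    (hκd z hz).add (contDiffAt_const.mul hb.contDiffAt)
  have hh' : ∀ z ∈ e.target, ‖fderiv ℝ h z - fderiv ℝ κ z‖ ≤ δ * L := by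
    intro z hz
    have h1 : HasFDerivAt h (fderiv ℝ κ z + δ • fderiv ℝ b z) z :=
      ((hκd z hz).differentiableAt one_ne_zero).hasFDerivAt.add
        ((hb.differentiable one_ne_zero z).hasFDerivAt.const_mul δ)
    rw [h1.fderiv, add_sub_cancel_left, norm_smul, Real.norm_of_nonneg hδ.le]
    exact mul_le_mul_of_nonneg_left (hb' z) hδ.le
  have hκh : ∀ z, κ z ≤ h z := fun z ↦ le_add_of_nonneg_right (mul_nonneg hδ.le (hb0 z))
  have hhκ : ∀ z, h z ≤ κ z + δ := fun z ↦
    add_le_add_right (mul_le_of_le_one_right hδ.le (hb1 z)) _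
  set O : Set Ω := {y | (y : M) ∈ e.source ∧ e y ∈ Metric.ball (e x) R} with hO
  have hOo : IsOpen O :=
    (e.isOpen_inter_preimage Metric.isOpen_ball).preimage continuous_subtype_val
  set T : Set Ω := {y | (y : M) ∈ e.symm '' Metric.closedBall (e x) (R / 2)} with hT
  have hTc : IsClosed T := (hRc (R / 2) (by linarith)).preimage continuous_subtype_val
  have hTO : T ⊆ O := by
    rintro y ⟨z, hz, hzy⟩
    have hzR := Metric.closedBall_subset_ball (by linarith : R / 2 < R) hz
    have hzt := hRt (Metric.ball_subset_closedBall hzR)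
    simp only [hO, mem_ofPred_eq, ← hzy, e.right_inv hzt]
    exact ⟨e.map_target hzt, hzR⟩
  have hOR : ∀ {y}, y ∈ O → e y ∈ Metric.closedBall (e x) R := fun hy ↦
    Metric.ball_subset_closedBall hy.2
  have hOκ : ∀ {y}, y ∈ O → κ (e y) ≤ U y := fun {y} hy ↦
    (((hRP y hy.1 (hOR hy)).2.1 hy.1)).trans (hvU y)
  -- Off the closed set `T` the bump vanishes and `h = κ ≤ U`, so `w = U` there. As `T ⊆ O`, the two
  -- formulas for `w` glue along an open cover.
  set w : Ω → ℝ := fun y ↦ if y ∈ O then max (U y) (h (e y)) else U y with hw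
  have hwO : ∀ {y}, y ∈ O → w y = max (U y) (h (e y)) := fun hy ↦ if_pos hy
  have hwT : ∀ {y}, y ∉ T → w y = U y := by
    intro y hy
    by_cases hyO : y ∈ O
    · rw [hwO hyO]
      refine max_eq_left ?_
      have : b (e y) = 0 := by
        refine hbR _ (not_lt.1 fun hlt ↦ hy ⟨e y, hlt.le, e.left_inv hyO.1⟩)
      simpa [hh, this] using hOκ hyO
    · exact if_neg hyO
  have hUw : ∀ y, U y ≤ w y := fun y ↦ by
    by_cases hyO : y ∈ O
    · rw [hwO hyO]; exact le_max_left _ _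
    · exact (if_neg hyO).ge
  have hwmem : w ∈ perronFamily F s₀ s₁ := by
    refine ⟨fun y ↦ (hU₀ y).trans (hUw y), fun y ↦ ?_, ?_, ?_⟩
    · by_cases hyO : y ∈ O
      · rw [hwO hyO]
        exact max_le (hU₁ y) (by linarith [(hRP y hyO.1 (hOR hyO)).2.2, hhκ (e y)])
      · rw [hw]; simpa [hyO] using hU₁ y
    · intro y t ht
      change w y < t at ht
      change ∀ᶠ y' in 𝓝 y, w y' < t
      have hUt := hUsub.1 y t ((hUw y).trans_lt ht)
      by_cases hyO : y ∈ O
      · rw [hwO hyO, max_lt_iff] at ht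
        have hc : ContinuousAt (fun y : Ω ↦ h (e y)) y :=
          ContinuousAt.comp (g := h) (hhd _ (e.map_source hyO.1)).continuousAt
            (ContinuousAt.comp (g := e) (e.continuousAt hyO.1)
              continuous_subtype_val.continuousAt)
        filter_upwards [hUt, hc.eventually (gt_mem_nhds ht.2), hOo.mem_nhds hyO] with q h1 h2 h3
        rw [hwO h3]
        exact max_lt h1 h2
      · filter_upwards [hUt, hTc.isOpen_compl.mem_nhds fun hyT ↦ hyO (hTO hyT)] with q h1 h2
        rwa [hwT h2]
    · rintro y _ ⟨g', hg', hmax, rfl⟩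
      -- Where `w = U`, a function touching `w` from above also touches `U`. Elsewhere it touches
      -- the `C¹` function `h`, so it has the derivative of `h`, for which `F < 0`.
      by_cases hyU : w y = U y
      · rw [hyU]
        refine hUsub.2 y _ ⟨g', hg', ?_, rfl⟩
        filter_upwards [hmax] with q hq
        linarith [hUw q]
      · have hyO : y ∈ O := by
          by_contra hyO
          exact hyU (if_neg hyO)
        have hyh : w y = h (e y) := by
          rw [hwO hyO] at hyU ⊢
          exact (max_choice _ _).resolve_left hyU
        have hyt := e.map_source hyO.1
        have hloc : IsLocalMax (fun z ↦ h z - (g' (e.symm z) + 0)) (e y) := by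
          have hev : ∀ᶠ q : Ω in 𝓝 y, (q : M) ∈ e.source ∧ h (e q) - g' q ≤ h (e y) - g' y := by
            filter_upwards [hmax, hOo.mem_nhds hyO] with q h1 h2
            refine ⟨h2.1, ?_⟩
            rw [hyh, hwO h2] at h1
            linarith [le_max_right (U q) (h (e q))]
          have hce := e.continuousAt_symm hyt
          rw [ContinuousAt, e.left_inv hyO.1] at hce
          filter_upwards [hce.eventually (TopologicalSpace.Opens.eventually_nhds_coe hev),
            e.open_target.mem_nhds hyt] with z ⟨_, h1⟩ h2
          simpa [e.right_inv h2, e.left_inv hyO.1] using h1.2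
        have hder : fderiv ℝ h (e y) = fderiv ℝ (fun z ↦ g' (e.symm z) + 0) (e y) := by
          have h1 := hloc.fderiv_eq_zero
          rw [fderiv_fun_sub ((hhd _ hyt).differentiableAt one_ne_zero)
            (((contDiffAt_comp_chartAt_symm hg' x hyt).add contDiffAt_const).differentiableAt
              one_ne_zero)] at h1
          exact sub_eq_zero.1 h1
        rw [mvfderiv_eq_chartCovector_symm hg' hyO.1 0, ← hder, hyh]
        have h1 := hRQ _ (hOR hyO)
        refine le_of_lt ((hRP y hyO.1 (hOR hyO)).1 _ ?_ _ ?_)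
        · have := norm_sub_le_norm_sub_add_norm_sub (fderiv ℝ h (e y)) (fderiv ℝ κ (e y))
            (fderiv ℝ κ (e x))
          linarith [hh' _ hyt, h1.1]
        · have h2 := abs_lt.1 h1.2
          rw [abs_lt]
          constructor <;> linarith [hκh (e y), hhκ (e y)]
  have hxO : x ∈ O := ⟨hxs, Metric.mem_ball_self hR⟩
  -- Maximality gives `h ≤ w ≤ U` near `x`, so the lower envelope at `x` would be at least `t₀ + δ`.
  have hfin := le_lowerEnvelope_of_eventually_le hs₀ hU₀ (hev (hhd _ hex).continuousAt) <| by
    filter_upwards [hOo.mem_nhds hxO] with y hy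
    exact (le_max_right (U y) _).trans ((hwO hy).ge.trans (hmaximal w hwmem y))
  simp only [hh, hκx, hba.self_of_nhds, ← ht₀] at hfin
  linarith

end Perron

/-! ### Assembly: the upper envelope is the largest element of the Perron family. -/

theorem mainTheorem9
    {X : Type*} [NormedAddCommGroup X] [NormedSpace ℝ X] [CompleteSpace X]
    (hX : HasC1LipschitzBump X)
    {M : Type*} [TopologicalSpace M] [T2Space M] [ParacompactSpace M] [ConnectedSpace M]
    [ChartedSpace X M] [IsManifold 𝓘(ℝ, X) 1 M]
    (N : TangentBundle 𝓘(ℝ, X) M → ℝ) (hN : IsPalaisFinsler N)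
    (Ω : TopologicalSpace.Opens M)
    (F : CotangentBundleOver X Ω × ℝ → ℝ) (hF : Continuous F)
    (s₀ s₁ : Ω → ℝ) (hs₀ : Continuous s₀) (hs₁ : Continuous s₁)
    (hsub : IsViscositySubsolution F s₀) (hsuper : IsViscositySupersolution F s₁)
    (hle : ∀ x, s₀ x ≤ s₁ x) :
    IsViscositySubsolution F (upperEnvelope (perronSup F s₀ s₁)) ∧
    IsViscositySupersolution F (lowerEnvelope (upperEnvelope (perronSup F s₀ s₁))) ∧
    (∀ x, s₀ x ≤ lowerEnvelope (upperEnvelope (perronSup F s₀ s₁)) x) ∧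
    (∀ x, lowerEnvelope (upperEnvelope (perronSup F s₀ s₁)) x ≤
      upperEnvelope (perronSup F s₀ s₁) x) ∧
    (∀ x, upperEnvelope (perronSup F s₀ s₁) x ≤ s₁ x) := by
  have hbdd : ∀ x, BddAbove {t : ℝ | ∃ w ∈ perronFamily F s₀ s₁, w x = t} := by
    intro x
    refine ⟨s₁ x, ?_⟩
    rintro _ ⟨w, hw, rfl⟩
    exact hw.2.1 x
  have hs₀mem : s₀ ∈ perronFamily F s₀ s₁ := ⟨fun _ ↦ le_rfl, hle, hsub⟩
  have hlub : ∀ x, IsLUB ((fun w : Ω → ℝ ↦ w x) '' perronFamily F s₀ s₁) (perronSup F s₀ s₁ x) :=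
    fun x ↦ isLUB_csSup ⟨_, s₀, hs₀mem, rfl⟩ (hbdd x)
  have hle₀ : ∀ x, s₀ x ≤ perronSup F s₀ s₁ x := fun x ↦ (hlub x).1 ⟨s₀, hs₀mem, rfl⟩
  have hle₁ : ∀ x, perronSup F s₀ s₁ x ≤ s₁ x := by
    refine fun x ↦ (hlub x).2 ?_
    rintro _ ⟨w, hw, rfl⟩
    exact hw.2.1 x
  have hu := isViscositySubsolution_upperEnvelope hX hF (fun w hw ↦ hw.2.2) hlub hs₁ hle₁
  have hleu := le_upperEnvelope hs₁ hle₁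
  have hu₀ : ∀ x, s₀ x ≤ upperEnvelope (perronSup F s₀ s₁) x := fun x ↦ (hle₀ x).trans (hleu x)
  have hu₁ : ∀ x, upperEnvelope (perronSup F s₀ s₁) x ≤ s₁ x := upperEnvelope_le hs₁ hle₁
  exact ⟨hu, isViscositySupersolution_lowerEnvelope hX hF hs₀ hs₁ hsuper ⟨hu₀, hu₁, hu⟩
    fun w hw y ↦ ((hlub y).1 ⟨w, hw, rfl⟩).trans (hleu y),
    le_lowerEnvelope hs₀ hu₀, lowerEnvelope_le hs₀ hu₀, hu₁⟩
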